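/- Let $\mathcal N$ be a finite set of $n$ agents and $\mathcal O$ a finite set of $m$ items. Every agent $i$ has an additive utility function $u_i:2^{\mathcal O}\to\mathbb R$, i.e. $u_i(S)=\sum_{o\in S}u_i(o)$ with $u_i(o):=u_i(\{o\})$; the utilities are normalized ternary, $u_i(o)\in\{-1,0,1\}$, and all items are goods, $u_i(o)\ge 0$ for all $i,o$ (so $u_i(o)\in\{0,1\}$). An allocation $\pi=(\pi_i)_{i\in\mathcal N}$ consists of pairwise disjoint bundles with $\bigcup_i\pi_i=\mathcal O$. Let $\vec u(\pi)\in\mathbb R^n$ be the vector of the utilities $u_i(\pi_i)$ sorted increasingly. For $\vec v,\vec w\in\mathbb R^n$ write $\vec v\succ_{lex}\vec w$ if there is an index $k$ with $\vec v_j=\vec w_j$ for all $j<k$ and $\vec v_k>\vec w_k$. The allocation $\pi$ is leximin-optimal if there is no allocation $\pi'$ with $\vec u(\pi')\succ_{lex}\vec u(\pi)$. The Darmann–Schauer network has the nodes $s$, $t$, one node for each item, one node for each agent, and nodes $t_{i,j}$ for $i\in\mathcal N$, $1\le j\le m$. Its edges, all of capacity $1$, are: $(s,o)$ of cost $0$ for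 every item $o$; $(o,i)$ of cost $0$ whenever $u_i(o)=1$; $(i,t_{i,j})$ of cost $n^j$ and $(t_{i,j},t)$ of cost $0$ for all $i,j$. The demands are $d(s)=m$, $d(t)=-m$ and $d(v)=0$ otherwise. A flow assigns a nonnegative real number to each edge; it is realizable if it respects the capacities and at each node $v$ the outgoing flow minus the incoming flow equals $d(v)$. Its cost is $\sum_e f(e)c(e)$. A minimum-cost integer flow is a realizable flow whose cost is minimal among all realizable flows and whose values are all integers. An integer flow $f$ defines an allocation by $o\in\pi_i$ if and only if $(o,i)$ is an edge and $f(o,i)=1$. Conversely, an allocation $\pi$ defines a function $f_\pi$ on the edges by $f_\pi(s,o)=1$; $f_\pi(o,i)=1$ if $o\in\pi_i$; $f_\pi(i,t_{i,j})=f_\pi(t_{i,j},t)=1$ if $j\le u_i(\pi_i)$; and $f_\pi=0$ otherwise. (1) Suppose that for every item $o$ there is an agent $i$ with $u_i(o)=1$. Then for every allocation $\pi$ the following are equivalent: (a) $\pi$ is leximin-optimal; (b) $\pi$ is the allocation defined by some minimum-cost integer flow of the network; (c) $f_\pi$ is a minimum-cost integer flow of the network. (2) (Without the supposition of (1).) Every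 leximin-optimal allocation $\pi$ maximizes the Nash social welfare $\prod_{i\in\mathcal N}|u_i(\pi_i)|$ among all allocations. -/

import Mathlib

open scoped NNReal

noncomputable section

namespace FairDivision

/-! ### Utilities and allocations

`N` is the finite set of agents and `O` the finite set of items. A utility profile is a family
`u : N → Finset O → ℝ` of real-valued functions on bundles. -/

section Allocations

variable {N O : Type*}

/-- The profile is additive: the utility of a bundle is the sum of the utilities of its items. -/
def IsAdditive (u : N → Finset O → ℝ) : Prop :=
  ∀ i S, u i S = ∑ o ∈ S, u i {o}

/-- Normalized ternary (symmetric) utilities: additive, with singletons valued in `{-1, 0, 1}`. -/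
def IsNormalizedTernary (u : N → Finset O → ℝ) : Prop :=
  IsAdditive u ∧ ∀ i o, u i {o} ∈ ({-1, 0, 1} : Set ℝ)

/-- Every item is a good for every agent. -/
def OnlyGoods (u : N → Finset O → ℝ) : Prop :=
  ∀ i o, 0 ≤ u i {o}

variable [Fintype N]

variable (N O) in
/-- A (complete) allocation: pairwise disjoint bundles whose union is the set of all items. -/
structure Allocation where
  bundle : N → Finset O
  disjoint : ∀ i j, i ≠ j → Disjoint (bundle i) (bundle j)
  exhaustive : ∀ o, ∃ i, o ∈ bundle i

/-- The list of the agents' utilities in `π`, sorted increasingly. -/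
def sortedUtilityList (u : N → Finset O → ℝ) (π : Allocation N O) : List ℝ :=
  ((Finset.univ : Finset N).val.map (fun i => u i (π.bundle i))).sort (· ≤ ·)

theorem length_sortedUtilityList (u : N → Finset O → ℝ) (π : Allocation N O) :
    (sortedUtilityList u π).length = Fintype.card N := by
  simp [sortedUtilityList, Finset.card_univ]

/-- The vector of the agents' utilities in `π`, sorted increasingly. -/
def sortedUtilities (u : N → Finset O → ℝ) (π : Allocation N O) : Fin (Fintype.card N) → ℝ :=
  fun k => (sortedUtilityList u π).get (k.cast (length_sortedUtilityList u π).symm)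

/-- `v` leximin-dominates `w`: at the first index at which they differ, `v` is larger. -/
def LeximinDominates {k : ℕ} (v w : Fin k → ℝ) : Prop :=
  ∃ i, (∀ j, j < i → v j = w j) ∧ w i < v i

/-- No allocation leximin-dominates `π`. -/
def IsLeximinOptimal (u : N → Finset O → ℝ) (π : Allocation N O) : Prop :=
  ¬ ∃ π' : Allocation N O, LeximinDominates (sortedUtilities u π') (sortedUtilities u π)

/-- The Nash social welfare. -/
def nashWelfare (u : N → Finset O → ℝ) (π : Allocation N O) : ℝ :=
  ∏ i, |u i (π.bundle i)|

def MaximizesNashWelfare (u : N → Finset O → ℝ) (π : Allocation N O) : Prop :=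
  ∀ π' : Allocation N O, nashWelfare u π' ≤ nashWelfare u π

end Allocations

/-! ### Cost flow networks -/

/-- A finite directed graph with demands on the nodes, and with positive capacities and
nonnegative costs on the edges. (Capacities and costs are only relevant on the edges.) -/
structure CostFlowNetwork (V : Type*) where
  edges : Finset (V × V)
  demand : V → ℝ
  capacity : V × V → ℝ
  cost : V × V → ℝ
  capacity_pos : ∀ e ∈ edges, 0 < capacity e
  cost_nonneg : ∀ e ∈ edges, 0 ≤ cost e

namespace CostFlowNetwork

variable {V : Type*} (G : CostFlowNetwork V)

/-- A flow assigns a nonnegative real number to every edge. -/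
abbrev Flow : Type _ := G.edges → ℝ≥0

variable {G}

open Classical in
/-- Outgoing flow minus incoming flow at the node `v`. -/
def netFlow (f : G.Flow) (v : V) : ℝ :=
  (∑ e : G.edges, if e.1.1 = v then (f e : ℝ) else 0) -
    ∑ e : G.edges, if e.1.2 = v then (f e : ℝ) else 0

def IsRealizable (f : G.Flow) : Prop :=
  (∀ e, (f e : ℝ) ≤ G.capacity e.1) ∧ ∀ v, netFlow f v = G.demand v

def flowCost (f : G.Flow) : ℝ :=
  ∑ e : G.edges, (f e : ℝ) * G.cost e.1

/-- A realizable flow whose cost is minimal among all realizable (real-valued) flows. -/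
def IsMinCost (f : G.Flow) : Prop :=
  IsRealizable f ∧ ∀ g : G.Flow, IsRealizable g → flowCost f ≤ flowCost g

def IsInteger (f : G.Flow) : Prop :=
  ∀ e, ∃ k : ℕ, f e = k

end CostFlowNetwork

/-! ### The Darmann–Schauer (Nash flow) network -/

/-- The nodes: source `s`, sink `t`, items, agents, and `t_{i,j}` for `i` an agent and
`j = 1, …, m`, where `m` is the number of items. Here `slot i j` is `t_{i,j+1}`, as `Fin m`
counts from `0`. -/
inductive Node (N O : Type*) [Fintype O] where
  | source : Node N O
  | sink : Node N O
  | item : O → Node N O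
  | agent : N → Node N O
  | slot : N → Fin (Fintype.card O) → Node N O
  deriving Fintype

section Network

variable {N O : Type*} [Fintype N] [Fintype O]

open Node

/-- The edges: `(s, o)`, `(o, i)` if `u_i(o) = 1`, `(i, t_{i,j})` and `(t_{i,j}, t)`. -/
def IsNashEdge (u : N → Finset O → ℝ) : Node N O × Node N O → Prop
  | (source, item _) => True
  | (item o, agent i) => u i {o} = 1
  | (agent i, slot i' _) => i' = i
  | (slot _ _, sink) => True
  | _ => False

/-- Demands: `m` at `s`, `-m` at `t`, and `0` elsewhere. -/
def nashDemand : Node N O → ℝ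
  | source => Fintype.card O
  | sink => -(Fintype.card O : ℝ)
  | _ => 0

/-- Costs: `n ^ j` on `(i, t_{i,j})`, where `n` is the number of agents, and `0` elsewhere. -/
def nashCost : Node N O × Node N O → ℝ
  | (agent _, slot _ j) => (Fintype.card N : ℝ) ^ ((j : ℕ) + 1)
  | _ => 0

open Classical in
/-- The network of the Nash flow algorithm; all capacities are `1`. -/
def nashNetwork (u : N → Finset O → ℝ) : CostFlowNetwork (Node N O) where
  edges := Finset.univ.filter (IsNashEdge u)
  demand := nashDemand
  capacity := fun _ => 1
  cost := nashCost
  capacity_pos := fun _ _ => one_pos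
  cost_nonneg := by
    intro e _
    unfold nashCost
    split <;> positivity

/-- `π` is the allocation defined by the flow `f`: `o ∈ π_i` if and only if `(o, i)` is an edge
and `f(o, i) = 1`. -/
def IsAllocationOfFlow {u : N → Finset O → ℝ} (f : (nashNetwork u).Flow)
    (π : Allocation N O) : Prop :=
  ∀ i o, o ∈ π.bundle i ↔
    ∃ h : (item o, agent i) ∈ (nashNetwork u).edges, f ⟨(item o, agent i), h⟩ = 1

open Classical in
/-- The flow defined by the allocation `π`: `f(s, o) = 1`; `f(o, i) = 1` if `o ∈ π_i`;
`f(i, t_{i,j}) = f(t_{i,j}, t) = 1` if `j ≤ u_i(π_i)`; all other values are `0`.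
(It is realizable only if every item goes to an agent with utility `1` for it.) -/
def flowOfAllocation (u : N → Finset O → ℝ) (π : Allocation N O) : (nashNetwork u).Flow :=
  fun e => match e.1 with
    | (source, item _) => 1
    | (item o, agent i) => if o ∈ π.bundle i then 1 else 0
    | (agent i, slot _ j) => if ((j : ℕ) + 1 : ℝ) ≤ u i (π.bundle i) then 1 else 0
    | (slot i j, sink) => if ((j : ℕ) + 1 : ℝ) ≤ u i (π.bundle i) then 1 else 0
    | _ => 0

end Network

end FairDivision

end

/-! Write `x i` for the number of liked items that agent `i` receives, and compare vectors by their
truncated sums `∑ i, min (x i) k`. Sums of a concave increasing function are controlled by these,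
via summation by parts.

The core is a characterization of leximin optimality (`isLeximinOptimal_iff`): no item is wasted,
and no chain of passed items leads from `i` to `j` with `x i ≥ x j + 2`. If such a chain exists,
moving one unit along it (`exists_transfer`) lowers no truncated sum and raises one. Conversely, a
cut argument (`IsBalanced.sum_min_le`) shows that a balanced non-wasteful allocation maximizes every
truncated sum, even among fractional allocations.

Maximal truncated sums have three consequences. Nothing leximin-dominates the allocation. Its Nash
welfare is maximal, because the increments of the logarithm decrease (`prod_le_prod_of_sum_min_le`).
When all items are liked by their owners, its flow has minimal cost, because the costs `n ^ j`
increase with `j` while the total flow is fixed (`le_flowCost`). In the other direction, an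
unbalanced integer flow is not cheapest: a transfer replaces a cost `n ^ (x i)` by the smaller `n ^
(x j + 1)`. -/

noncomputable section

namespace FairDivision

open Finset Relation CostFlowNetwork

/-! ### Passing items along chains, and the cut bound for balanced allocations. -/

section Transfers

open Classical

variable {N O : Type*}

/-- The number of items that `a` gives to `i` and that `i` likes. -/
def likedCount [Fintype O] (L : N → O → Prop) (a : O → N) (i : N) : ℕ :=
  ∑ o, if a o = i ∧ L i o then 1 else 0

/-- Every item that somebody likes is given to somebody who likes it. -/
def NonWasteful (L : N → O → Prop) (a : O → N) : Prop :=
  ∀ i o, L i o → L (a o) o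

/-- Some item of `p` is liked by `q`. -/
def CanPass (L : N → O → Prop) (a : O → N) (p q : N) : Prop :=
  ∃ o, a o = p ∧ L q o

/-- No chain of passed items leads from an agent to one that is poorer by two or more. -/
def IsBalanced [Fintype O] (L : N → O → Prop) (a : O → N) : Prop :=
  ∀ i j, ReflTransGen (CanPass L a) i j → likedCount L a i ≤ likedCount L a j + 1

variable {L : N → O → Prop} {a : O → N}

theorem NonWasteful.update (ha : NonWasteful L a) {o : O} {q : N} (hq : L q o) :
    NonWasteful L (Function.update a o q) := by
  intro i o' h
  by_cases ho : o' = o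
  · subst ho; simpa using hq
  · rw [Function.update_of_ne ho]; exact ha i o' h

theorem NonWasteful.likes_owner {L : N → O → Prop} {a : O → N} (h : NonWasteful L a)
    (hex : ∀ o, ∃ i, L i o) (o : O) : L (a o) o :=
  (hex o).elim fun i hi => h i o hi

/-- A path can be chosen not to return to its starting point. -/
theorem exists_reflTransGen_avoiding {r : N → N → Prop} {i j : N} (h : ReflTransGen r i j)
    (hij : i ≠ j) :
    ∃ p, r i p ∧ ReflTransGen (fun x y => r x y ∧ x ≠ i ∧ y ≠ i) p j := by
  -- Reading the path backwards from `j`, the second alternative arises at the last visit to `i` and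
  -- persists from there.
  have key : ∀ c, ReflTransGen r c j → ReflTransGen (fun x y => r x y ∧ x ≠ i ∧ y ≠ i) c j ∨
      ∃ p, r i p ∧ ReflTransGen (fun x y => r x y ∧ x ≠ i ∧ y ≠ i) p j := by
    intro c hc
    induction hc using ReflTransGen.head_induction_on with
    | refl => exact Or.inl .refl
    | @head c d hcd _ ih =>
      rcases ih with ih | ih
      · by_cases hci : c = i
        · subst hci; exact Or.inr ⟨d, hcd, ih⟩
        · by_cases hdi : d = i
          · subst hdi
            rcases ReflTransGen.cases_head ih with h | ⟨_, h, _⟩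
            · exact absurd h hij
            · exact absurd rfl h.2.1
          · exact Or.inl (.head ⟨hcd, hci, hdi⟩ ih)
      · exact Or.inr ih
  rcases key i h with h | h
  · rcases ReflTransGen.cases_head h with h | ⟨_, h, _⟩
    · exact absurd h hij
    · exact absurd rfl h.2.1
  · exact h

variable [Fintype O]

theorem likedCount_le_card (L : N → O → Prop) (a : O → N) (i : N) :
    likedCount L a i ≤ Fintype.card O := by
  unfold likedCount
  calc _ ≤ ∑ _o : O, 1 := Finset.sum_le_sum fun o _ => by split_ifs <;> simp
    _ = _ := by simp

theorem likedCount_update (L : N → O → Prop) (a : O → N) (o : O) (q i : N) :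
    likedCount L (Function.update a o q) i + (if a o = i ∧ L i o then 1 else 0) =
      likedCount L a i + (if q = i ∧ L i o then 1 else 0) := by
  unfold likedCount
  rw [← Finset.add_sum_erase univ _ (mem_univ o),
    ← Finset.add_sum_erase univ (fun o => if a o = i ∧ L i o then 1 else 0) (mem_univ o)]
  have : ∑ x ∈ univ.erase o, (if Function.update a o q x = i ∧ L i x then 1 else 0) =
      ∑ x ∈ univ.erase o, (if a x = i ∧ L i x then 1 else 0) :=
    Finset.sum_congr rfl fun x hx => by rw [Function.update_of_ne (Finset.ne_of_mem_erase hx)]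
  rw [this, Function.update_self]
  ring

theorem likedCount_update_of_nonWasteful (ha : NonWasteful L a) {o : O} {q : N} (hq : L q o) :
    likedCount L (Function.update a o q) + Pi.single (a o) 1 =
      likedCount L a + Pi.single q 1 := by
  funext i
  have h := likedCount_update L a o q i
  have h₁ : (if a o = i ∧ L i o then 1 else 0) = (Pi.single (a o) 1 : N → ℕ) i := by
    by_cases hi : a o = i
    · subst hi; simp [ha q o hq]
    · simp [hi, Ne.symm hi]
  have h₂ : (if q = i ∧ L i o then 1 else 0) = (Pi.single q 1 : N → ℕ) i := by
    by_cases hi : q = i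
    · subst hi; simp [hq]
    · simp [hi, Ne.symm hi]
  rw [h₁, h₂] at h
  exact h

theorem likedCount_update_of_wasted {o : O} {q : N} (ho : ¬ L (a o) o) (hq : L q o) :
    likedCount L (Function.update a o q) = likedCount L a + Pi.single q 1 := by
  funext i
  have h := likedCount_update L a o q i
  have h₁ : ¬ (a o = i ∧ L i o) := by rintro ⟨rfl, h⟩; exact ho h
  have h₂ : (if q = i ∧ L i o then 1 else 0) = (Pi.single q 1 : N → ℕ) i := by
    by_cases hi : q = i
    · subst hi; simp [hq]
    · simp [hi, Ne.symm hi]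
  rw [if_neg h₁, h₂] at h
  exact h

/-- Items are passed one at a time, so a pass could destroy later links of the chain. Once the chain
is chosen never to return to `i`, the first pass removes an item only from `i`, so the remaining
links survive and lie in `s` without `i`. This is why the set of permitted agents is carried along
for the induction, with `a` generalized. -/
theorem exists_transfer_within (s : Finset N) :
    ∀ {a : O → N}, NonWasteful L a → ∀ {i j : N}, i ≠ j →
      ReflTransGen (fun x y => CanPass L a x y ∧ x ∈ s ∧ y ∈ s) i j →
      ∃ a' : O → N, NonWasteful L a' ∧
        likedCount L a' + Pi.single i 1 = likedCount L a + Pi.single j 1 := by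
  induction s using Finset.strongInduction with
  | H s ih =>
    intro a ha i j hij h
    obtain ⟨p, ⟨⟨o, rfl, hpo⟩, his, -⟩, hpj⟩ := exists_reflTransGen_avoiding h hij
    have h₁ := likedCount_update_of_nonWasteful ha hpo
    by_cases hp : p = j
    · subst hp; exact ⟨_, ha.update hpo, h₁⟩
    · have hsub : ∀ x y, ((CanPass L a x y ∧ x ∈ s ∧ y ∈ s) ∧ x ≠ a o ∧ y ≠ a o) →
          CanPass L (Function.update a o p) x y ∧ x ∈ s.erase (a o) ∧ y ∈ s.erase (a o) := by
        rintro x y ⟨⟨⟨o', rfl, hy⟩, hx, hys⟩, hxi, hyi⟩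
        refine ⟨⟨o', Function.update_of_ne ?_ _ _, hy⟩, Finset.mem_erase.2 ⟨hxi, hx⟩,
          Finset.mem_erase.2 ⟨hyi, hys⟩⟩
        rintro rfl
        exact hxi rfl
      obtain ⟨a', ha', h₂⟩ := ih _ (Finset.erase_ssubset his) (ha.update hpo) hp
        (ReflTransGen.mono hsub _ _ hpj)
      refine ⟨a', ha', ?_⟩
      funext k
      have e₁ := congrFun h₁ k
      have e₂ := congrFun h₂ k
      simp only [Pi.add_apply] at e₁ e₂ ⊢
      omega

/-- If a chain of passed items leads from `i` to `j`, then one unit of utility can be moved from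
`i` to `j`. -/
theorem exists_transfer [Fintype N] (ha : NonWasteful L a) {i j : N} (hij : i ≠ j)
    (h : ReflTransGen (CanPass L a) i j) :
    ∃ a' : O → N, NonWasteful L a' ∧
      likedCount L a' + Pi.single i 1 = likedCount L a + Pi.single j 1 :=
  exists_transfer_within univ ha hij (ReflTransGen.mono (fun _ _ h => ⟨h, mem_univ _, mem_univ _⟩) _ _ h)

theorem sum_likedCount [Fintype N] (ha : ∀ o, L (a o) o) :
    ∑ i, likedCount L a i = Fintype.card O := by
  unfold likedCount
  rw [Finset.sum_comm]
  have : ∀ o, (∑ i, if a o = i ∧ L i o then 1 else 0) = 1 := by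
    intro o
    rw [Finset.sum_eq_single (a o)]
    · simp [ha o]
    · intro i _ hi; simp [Ne.symm hi]
    · simp
  simp [this]

/-- The truncated sums of a balanced, non-wasteful allocation are maximal, even among fractional
allocations. -/
theorem IsBalanced.sum_min_le [Fintype N] (hb : IsBalanced L a) (ha : NonWasteful L a)
    (z : O → N → ℝ) (hz₀ : ∀ o i, 0 ≤ z o i) (hzL : ∀ o i, z o i ≠ 0 → L i o)
    (hz₁ : ∀ o, ∑ i, z o i ≤ 1) (k : ℕ) :
    ∑ i, min (∑ o, z o i) (k : ℝ) ≤ ∑ i, min (likedCount L a i : ℝ) k := by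
  -- `R` is one side of a minimum cut: balancedness gives at most `k` liked items to each agent in
  -- `R`, and every agent outside has at least `k`. The truncation is thus inactive on `R` and
  -- saturated off `R`.
  let R : Finset N := {i | ∃ j, likedCount L a j < k ∧ ReflTransGen (CanPass L a) i j}
  have hR : ∀ i, i ∈ R ↔ ∃ j, likedCount L a j < k ∧ ReflTransGen (CanPass L a) i j := by
    simp [R]
  have hsum : ∑ i ∈ R, ∑ o, z o i ≤ ∑ i ∈ R, (likedCount L a i : ℝ) := by
    simp only [likedCount, Nat.cast_sum]
    rw [Finset.sum_comm, Finset.sum_comm (s := R)]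
    refine Finset.sum_le_sum fun o _ => ?_
    -- An item liked by a member of `R` is already owned inside `R`, since its owner can pass it
    -- there. It contributes a full unit, which no fractional allocation exceeds.
    by_cases h : ∃ i ∈ R, L i o
    · obtain ⟨i, hi, hio⟩ := h
      obtain ⟨j, hj, hij⟩ := (hR i).1 hi
      have hao : a o ∈ R := (hR _).2 ⟨j, hj, .head ⟨o, rfl, hio⟩ hij⟩
      calc ∑ i ∈ R, z o i ≤ ∑ i, z o i :=
            Finset.sum_le_univ_sum_of_nonneg fun i => hz₀ o i
        _ ≤ 1 := hz₁ o
        _ = ((if a o = a o ∧ L (a o) o then 1 else 0 : ℕ) : ℝ) := by simp [ha i o hio]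
        _ ≤ _ := Finset.single_le_sum
            (f := fun i => ((if a o = i ∧ L i o then 1 else 0 : ℕ) : ℝ))
            (fun _ _ => Nat.cast_nonneg _) hao
    · rw [Finset.sum_eq_zero]
      · exact Finset.sum_nonneg fun _ _ => Nat.cast_nonneg _
      · intro i hi
        by_contra hne
        exact h ⟨i, hi, hzL o i hne⟩
  rw [← Finset.sum_add_sum_compl R, ← Finset.sum_add_sum_compl R fun i => min (likedCount L a i : ℝ) k]
  refine add_le_add ?_ (Finset.sum_le_sum fun i hi => ?_)
  · calc ∑ i ∈ R, min (∑ o, z o i) (k : ℝ) ≤ ∑ i ∈ R, ∑ o, z o i :=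
          Finset.sum_le_sum fun _ _ => min_le_left _ _
      _ ≤ _ := hsum
      _ = _ := Finset.sum_congr rfl fun i hi => by
          obtain ⟨j, hj, hij⟩ := (hR i).1 hi
          have := hb i j hij
          rw [min_eq_left]
          exact_mod_cast (by omega : likedCount L a i ≤ k)
  · have : k ≤ likedCount L a i := by
      by_contra hlt
      exact (Finset.mem_compl.1 hi) ((hR i).2 ⟨i, by omega, .refl⟩)
    rw [min_eq_right (by exact_mod_cast this : (k : ℝ) ≤ likedCount L a i)]
    exact min_le_right _ _

/-- An arbitrary allocation becomes a fractional one after discarding the items whose owners do not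
like them; this is why the fractional row sums are only required to be at most `1`. -/
theorem sum_min_likedCount_le [Fintype N] (hb : IsBalanced L a) (ha : NonWasteful L a)
    (a' : O → N) (k : ℕ) :
    ∑ i, min (likedCount L a' i : ℝ) k ≤ ∑ i, min (likedCount L a i : ℝ) k := by
  have := hb.sum_min_le ha (fun o i => if a' o = i ∧ L i o then 1 else 0)
    (fun o i => by positivity) (fun o i h => by
      by_contra hL; simp [hL] at h)
    (fun o => by
      calc _ ≤ ∑ i, (if a' o = i then (1 : ℝ) else 0) :=
            Finset.sum_le_sum fun i _ => by split_ifs <;> simp_all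
        _ ≤ 1 := by simp) k
  simpa [likedCount] using this

end Transfers

/-! ### From truncated sums to concave sums and products. -/

section Majorization

/-- Summation by parts for an antitone sequence of coefficients. -/
theorem mul_sum_le_sum_mul {d h : ℕ → ℝ} (hd : Antitone d)
    (hh : ∀ k, 0 ≤ ∑ j ∈ range k, h j) (m : ℕ) :
    d m * ∑ j ∈ range m, h j ≤ ∑ j ∈ range m, d j * h j := by
  induction m with
  | zero => simp
  | succ m ih =>
    calc _ ≤ d m * ∑ j ∈ range (m + 1), h j :=
          mul_le_mul_of_nonneg_right (hd m.le_succ) (hh _)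
      _ ≤ _ := by rw [Finset.sum_range_succ, Finset.sum_range_succ, mul_add]; linarith

theorem sum_range_ite_lt {M : Type*} [AddCommMonoid M] (d : ℕ → M) {x m : ℕ} (hx : x ≤ m) :
    ∑ j ∈ range m, (if j < x then d j else 0) = ∑ j ∈ range x, d j := by
  rw [← Finset.sum_filter]
  congr 1
  ext j
  simp only [Finset.mem_filter, Finset.mem_range]
  omega

theorem sum_range_ite_lt_one (x k : ℕ) :
    ∑ j ∈ range k, (if j < x then (1 : ℝ) else 0) = min (x : ℝ) k := by
  rw [← Finset.sum_filter, Finset.sum_const, nsmul_one]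
  have : (range k).filter (· < x) = range (min x k) := by
    ext j; simp only [Finset.mem_filter, Finset.mem_range]; omega
  rw [this, Finset.card_range, Nat.cast_min]

/-- Larger truncated sums give larger sums of a concave increasing function. -/
theorem sum_sum_range_le {N : Type*} [Fintype N] {x y : N → ℕ}
    (h : ∀ k : ℕ, ∑ i, min (y i : ℝ) k ≤ ∑ i, min (x i : ℝ) k) {d : ℕ → ℝ} (hd : Antitone d)
    (hd₀ : ∀ j, 0 ≤ d j) :
    ∑ i, ∑ j ∈ range (y i), d j ≤ ∑ i, ∑ j ∈ range (x i), d j := by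
  -- Any common upper bound for all entries would do.
  set m := ∑ i, (x i + y i)
  have hm : ∀ i, x i + y i ≤ m := fun i =>
    Finset.single_le_sum (f := fun i => x i + y i) (fun _ _ => Nat.zero_le _) (mem_univ i)
  have key : ∀ w : N → ℕ, (∀ i, w i ≤ m) → ∑ i, ∑ j ∈ range (w i), d j =
      ∑ j ∈ range m, d j * ∑ i, (if j < w i then (1 : ℝ) else 0) := by
    intro w hw
    calc _ = ∑ i, ∑ j ∈ range m, (if j < w i then d j else 0) :=
          Finset.sum_congr rfl fun i _ => (sum_range_ite_lt d (hw i)).symm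
      _ = _ := by
          rw [Finset.sum_comm]
          refine Finset.sum_congr rfl fun j _ => ?_
          rw [Finset.mul_sum]
          exact Finset.sum_congr rfl fun i _ => by split_ifs <;> simp
  rw [key y fun i => by have := hm i; omega, key x fun i => by have := hm i; omega, ← sub_nonneg,
    ← Finset.sum_sub_distrib]
  simp only [← mul_sub]
  have hh : ∀ k, 0 ≤ ∑ j ∈ range k, ((∑ i, if j < x i then (1 : ℝ) else 0) -
      ∑ i, if j < y i then (1 : ℝ) else 0) := by
    intro k
    rw [Finset.sum_sub_distrib, Finset.sum_comm, Finset.sum_comm (s := range k) (t := univ)]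
    simp only [sum_range_ite_lt_one]
    exact sub_nonneg.2 (h k)
  exact (mul_nonneg (hd₀ m) (hh m)).trans (mul_sum_le_sum_mul hd hh m)

theorem log_eq_sum_range (n : ℕ) :
    Real.log ((n + 1 : ℕ) : ℝ) =
      ∑ j ∈ range n, (Real.log ((j + 1 + 1 : ℕ) : ℝ) - Real.log ((j + 1 : ℕ) : ℝ)) := by
  rw [Finset.sum_range_sub (fun j => Real.log ((j + 1 : ℕ) : ℝ))]
  simp

theorem antitone_log_sub_log :
    Antitone fun j : ℕ => Real.log ((j + 1 + 1 : ℕ) : ℝ) - Real.log ((j + 1 : ℕ) : ℝ) := by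
  refine antitone_nat_of_succ_le fun j => ?_
  rw [← Real.log_div (by positivity) (by positivity), ← Real.log_div (by positivity) (by positivity)]
  refine Real.log_le_log (by positivity) ?_
  rw [div_le_div_iff₀ (by positivity) (by positivity)]
  push_cast
  nlinarith

/-- Larger truncated sums give larger products. -/
theorem prod_le_prod_of_sum_min_le {N : Type*} [Fintype N] {x y : N → ℕ}
    (h : ∀ k : ℕ, ∑ i, min (y i : ℝ) k ≤ ∑ i, min (x i : ℝ) k) :
    ∏ i, (y i : ℝ) ≤ ∏ i, (x i : ℝ) := by
  by_cases hy : ∃ i, y i = 0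
  · obtain ⟨i, hi⟩ := hy
    rw [Finset.prod_eq_zero (mem_univ i) (by simp [hi])]
    positivity
  push Not at hy
  -- The truncation at `1` counts positive entries, and all entries of `y` are positive.
  have hx : ∀ i, x i ≠ 0 := by
    intro i hi
    have h1 := h 1
    refine absurd h1 (not_le.2 (Finset.sum_lt_sum (fun j _ => ?_) ⟨i, mem_univ i, ?_⟩))
    · have : (1 : ℝ) ≤ y j := by exact_mod_cast Nat.one_le_iff_ne_zero.2 (hy j)
      rw [Nat.cast_one, min_eq_right this]
      exact min_le_right _ _
    · have : (1 : ℝ) ≤ y i := by exact_mod_cast Nat.one_le_iff_ne_zero.2 (hy i)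
      rw [Nat.cast_one, min_eq_right this, hi]
      simp
  -- Shifting by one starts the telescoping sum at `log 1 = 0` and avoids `log 0`. The hypothesis
  -- for the shifted vectors at `k` is the original one at `k + 1`.
  obtain ⟨x, rfl⟩ : ∃ x' : N → ℕ, x = fun i => x' i + 1 :=
    ⟨fun i => x i - 1, funext fun i => (Nat.succ_pred (hx i)).symm⟩
  obtain ⟨y, rfl⟩ : ∃ y' : N → ℕ, y = fun i => y' i + 1 :=
    ⟨fun i => y i - 1, funext fun i => (Nat.succ_pred (hy i)).symm⟩
  have hlog : ∑ i, Real.log ((y i + 1 : ℕ) : ℝ) ≤ ∑ i, Real.log ((x i + 1 : ℕ) : ℝ) := by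
    rw [Finset.sum_congr rfl fun i _ => log_eq_sum_range (y i),
      Finset.sum_congr rfl fun i _ => log_eq_sum_range (x i)]
    refine sum_sum_range_le (fun k => ?_) antitone_log_sub_log fun j =>
      sub_nonneg.2 (Real.log_le_log (by positivity) (by exact_mod_cast Nat.le_succ _))
    have := h (k + 1)
    simpa only [Nat.cast_add, Nat.cast_one, min_add_add_right, Finset.sum_add_distrib,
      add_le_add_iff_right] using this
  rw [← Real.log_prod fun i _ => by positivity, ← Real.log_prod fun i _ => by positivity] at hlog
  exact (Real.log_le_log_iff (by positivity) (by positivity)).1 hlog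

end Majorization

/-! ### Flows as functions on all pairs of nodes. -/

section ExtendedFlow

open Classical

variable {V : Type*} {G : CostFlowNetwork V}

/-- The flow as a function on all pairs of nodes, `0` off the edges. -/
def extend (f : G.Flow) (e : V × V) : ℝ :=
  if h : e ∈ G.edges then (f ⟨e, h⟩ : ℝ) else 0

theorem extend_of_mem (f : G.Flow) {e : V × V} (h : e ∈ G.edges) :
    extend f e = f ⟨e, h⟩ := dif_pos h

theorem extend_of_not_mem (f : G.Flow) {e : V × V} (h : e ∉ G.edges) : extend f e = 0 := dif_neg h

theorem extend_nonneg (f : G.Flow) (e : V × V) : 0 ≤ extend f e := by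
  unfold extend; split_ifs <;> simp

theorem sum_edges_eq_sum_extend [Fintype V] (f : G.Flow) (c : V × V → ℝ) :
    ∑ e : G.edges, (f e : ℝ) * c e.1 = ∑ v, ∑ w, extend f (v, w) * c (v, w) := by
  rw [← Fintype.sum_prod_type fun e => extend f e * c e,
    ← Finset.sum_subset (Finset.subset_univ G.edges),
    ← Finset.sum_coe_sort G.edges fun e => extend f e * c e]
  · exact Finset.sum_congr rfl fun e _ => by rw [extend_of_mem f e.2]
  · intro e _ he
    rw [extend_of_not_mem f he, zero_mul]

theorem netFlow_eq [Fintype V] (f : G.Flow) (v : V) :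
    netFlow f v = ∑ w, extend f (v, w) - ∑ w, extend f (w, v) := by
  have h₁ := sum_edges_eq_sum_extend f fun e => if e.1 = v then 1 else 0
  have h₂ := sum_edges_eq_sum_extend f fun e => if e.2 = v then 1 else 0
  simp only [mul_ite, mul_one, mul_zero] at h₁ h₂
  rw [netFlow, h₁, h₂, Finset.sum_comm]
  simp

theorem flowCost_eq [Fintype V] (f : G.Flow) :
    flowCost f = ∑ v, ∑ w, extend f (v, w) * G.cost (v, w) :=
  sum_edges_eq_sum_extend f G.cost

end ExtendedFlow

/-! ### Net flows and cost in the Darmann–Schauer network. -/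

section NashNetwork

open Node

variable {N O : Type*} [Fintype N] [Fintype O]

/-- A node is the source, the sink, an item, an agent or a slot. -/
def nodeEquiv : Node N O ≃ Unit ⊕ Unit ⊕ O ⊕ N ⊕ (N × Fin (Fintype.card O)) where
  toFun
    | source => .inl ()
    | sink => .inr (.inl ())
    | item o => .inr (.inr (.inl o))
    | agent i => .inr (.inr (.inr (.inl i)))
    | slot i j => .inr (.inr (.inr (.inr (i, j))))
  invFun
    | .inl _ => source
    | .inr (.inl _) => sink
    | .inr (.inr (.inl o)) => item o
    | .inr (.inr (.inr (.inl i))) => agent i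
    | .inr (.inr (.inr (.inr (i, j)))) => slot i j
  left_inv v := by cases v <;> rfl
  right_inv v := by rcases v with _ | _ | _ | _ | _ <;> rfl

theorem sum_node (F : Node N O → ℝ) :
    ∑ v, F v = F source + (F sink + (∑ o, F (item o) + (∑ i, F (agent i) +
      ∑ i, ∑ j, F (slot i j)))) := by
  rw [Fintype.sum_equiv nodeEquiv F (fun v => F (nodeEquiv.symm v)) fun v => by simp]
  simp only [Fintype.sum_sum_type, Fintype.sum_prod_type, Finset.univ_unique,
    Finset.sum_singleton]
  rfl

variable {u : N → Finset O → ℝ}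

theorem mem_edges {e : Node N O × Node N O} : e ∈ (nashNetwork u).edges ↔ IsNashEdge u e := by
  classical
  simp [nashNetwork]

theorem extend_of_not_isNashEdge (f : (nashNetwork u).Flow) {e : Node N O × Node N O}
    (h : ¬ IsNashEdge u e) : extend f e = 0 := extend_of_not_mem f (mem_edges.not.2 h)

variable (f : (nashNetwork u).Flow)

theorem extend_eq_zero :
    (∀ v, extend f (sink, v) = 0) ∧ (∀ v, extend f (v, source) = 0) ∧
    extend f (source, sink) = 0 ∧ (∀ i, extend f (source, agent i) = 0) ∧
    (∀ i j, extend f (source, slot i j) = 0) ∧ (∀ o, extend f (item o, sink) = 0) ∧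
    (∀ o o', extend f (item o, item o') = 0) ∧ (∀ o i j, extend f (item o, slot i j) = 0) ∧
    (∀ i, extend f (agent i, sink) = 0) ∧ (∀ i o, extend f (agent i, item o) = 0) ∧
    (∀ i i', extend f (agent i, agent i') = 0) ∧ (∀ i j o, extend f (slot i j, item o) = 0) ∧
    (∀ i j i', extend f (slot i j, agent i') = 0) ∧
    ∀ i j i' j', extend f (slot i j, slot i' j') = 0 := by
  refine ⟨?_, ?_, ?_, ?_, ?_, ?_, ?_, ?_, ?_, ?_, ?_, ?_, ?_, ?_⟩ <;> intros <;>
    exact extend_of_not_isNashEdge f (by simp [IsNashEdge])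

theorem sum_slot_extend (i : N) :
    ∑ i', ∑ j, extend f (agent i, slot i' j) = ∑ j, extend f (agent i, slot i j) := by
  refine Finset.sum_eq_single i (fun i' _ hi' => Finset.sum_eq_zero fun j _ =>
    extend_of_not_isNashEdge f ?_) (by simp)
  simpa [IsNashEdge] using hi'

theorem netFlow_source : netFlow f source = ∑ o, extend f (source, item o) := by
  rw [netFlow_eq, sum_node, sum_node]
  simp [extend_eq_zero f]

theorem netFlow_sink : netFlow f sink = -∑ i, ∑ j, extend f (slot i j, sink) := by
  rw [netFlow_eq, sum_node, sum_node]
  simp [extend_eq_zero f]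

theorem netFlow_item (o : O) :
    netFlow f (item o) = ∑ i, extend f (item o, agent i) - extend f (source, item o) := by
  rw [netFlow_eq, sum_node, sum_node]
  simp [extend_eq_zero f]

theorem netFlow_agent (i : N) :
    netFlow f (agent i) =
      ∑ j, extend f (agent i, slot i j) - ∑ o, extend f (item o, agent i) := by
  rw [netFlow_eq, sum_node, sum_node, sum_slot_extend]
  simp [extend_eq_zero f]

theorem netFlow_slot (i : N) (j : Fin (Fintype.card O)) :
    netFlow f (slot i j) = extend f (slot i j, sink) - extend f (agent i, slot i j) := by
  rw [netFlow_eq, sum_node, sum_node, Finset.sum_eq_single (f := fun i' =>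
    extend f (agent i', slot i j)) i]
  · simp [extend_eq_zero f]
  · intro i' _ hi'
    exact extend_of_not_isNashEdge f (by simpa [IsNashEdge] using hi'.symm)
  · simp

theorem flowCost_nashNetwork :
    flowCost f =
      ∑ i, ∑ j, extend f (agent i, slot i j) * (Fintype.card N : ℝ) ^ ((j : ℕ) + 1) := by
  have hc : (nashNetwork u).cost = nashCost := rfl
  rw [flowCost_eq, sum_node]
  simp only [sum_node, hc, nashCost, mul_zero, Finset.sum_const_zero, add_zero, zero_add]
  refine Finset.sum_congr rfl fun i _ => Finset.sum_eq_single i (fun i' _ hi' =>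
    Finset.sum_eq_zero fun j _ => ?_) (by simp)
  rw [extend_of_not_isNashEdge, zero_mul]
  simpa [IsNashEdge] using hi'

end NashNetwork

/-! ### Leximin order and truncated sums of sorted vectors. -/

section SortedVectors

/-- Truncate at `k = v i`, where `i` is the first difference. Earlier terms agree; from `i` on, the
terms of the sorted vector `v` equal the cap `k`, while `w i` stays below it. So the truncated sum
of `v` would be strictly larger. -/
theorem not_leximinDominates_of_sum_min_le {n : ℕ} {v w : Fin n → ℝ} (hv : Monotone v)
    (hvN : ∀ j, ∃ k : ℕ, v j = k)
    (h : ∀ k : ℕ, ∑ j, min (v j) (k : ℝ) ≤ ∑ j, min (w j) (k : ℝ)) : ¬ LeximinDominates v w := by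
  rintro ⟨i, hlt, hi⟩
  obtain ⟨k, hk⟩ := hvN i
  refine absurd (h k) (not_le.2 (Finset.sum_lt_sum (fun j _ => ?_) ⟨i, mem_univ i, ?_⟩))
  · rcases lt_or_ge j i with hj | hj
    · rw [hlt j hj]
    · exact (min_le_right _ _).trans_eq (min_eq_right (hk ▸ hv hj)).symm
  · rw [← hk, min_self, min_eq_left hi.le]
    exact hi

theorem leximinDominates_of_sum_min_lt {n : ℕ} {v w : Fin n → ℝ} (hw : Monotone w)
    (hwN : ∀ j, ∃ k : ℕ, w j = k)
    (h : ∀ k : ℕ, ∑ j, min (w j) (k : ℝ) ≤ ∑ j, min (v j) (k : ℝ))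
    (hlt : ∃ k : ℕ, ∑ j, min (w j) (k : ℝ) < ∑ j, min (v j) (k : ℝ)) : LeximinDominates v w := by
  have hne : ∃ i, v i ≠ w i := by
    by_contra! hvw
    obtain ⟨k, hk⟩ := hlt
    rw [funext hvw] at hk
    exact lt_irrefl _ hk
  obtain ⟨i, hi, hmin⟩ := WellFounded.has_min (wellFounded_lt (α := Fin n)) {i | v i ≠ w i} hne
  have heq : ∀ j, j < i → v j = w j := fun j hj => by
    by_contra hj'
    exact hmin j hj' hj
  rcases lt_or_gt_of_ne hi with hvw | hvw
  · exact absurd ⟨i, fun j hj => (heq j hj).symm, hvw⟩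
      (not_leximinDominates_of_sum_min_le hw hwN h)
  · exact ⟨i, heq, hvw⟩

variable {N O : Type*} [Fintype N]

theorem monotone_sortedUtilities (u : N → Finset O → ℝ) (π : Allocation N O) :
    Monotone (sortedUtilities u π) := by
  have h : (sortedUtilityList u π).SortedLE :=
    (Multiset.pairwise_sort _ _).sortedLE
  exact fun i j hij => h.monotone_get (by simpa using hij)

theorem sum_sortedUtilities (u : N → Finset O → ℝ) (π : Allocation N O) (F : ℝ → ℝ) :
    ∑ k, F (sortedUtilities u π k) = ∑ i, F (u i (π.bundle i)) := by
  have h₁ : ∑ k, F (sortedUtilities u π k) =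
      ∑ k : Fin (sortedUtilityList u π).length, F ((sortedUtilityList u π).get k) :=
    Fintype.sum_equiv (finCongr (length_sortedUtilityList u π).symm) _ _ fun _ => rfl
  have h₂ : ((sortedUtilityList u π).map F : Multiset ℝ) =
      univ.val.map fun i => F (u i (π.bundle i)) := by
    rw [← Multiset.map_coe, sortedUtilityList, Multiset.sort_eq, Multiset.map_map]
    rfl
  rw [h₁]
  calc _ = ((sortedUtilityList u π).map F).sum := by
        simp only [List.get_eq_getElem]
        exact Fin.sum_univ_fun_getElem _ _
    _ = _ := by rw [← Multiset.sum_coe, h₂]; rfl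

theorem exists_sortedUtilities_eq (u : N → Finset O → ℝ) (π : Allocation N O)
    (k : Fin (Fintype.card N)) : ∃ i, sortedUtilities u π k = u i (π.bundle i) := by
  have h : sortedUtilities u π k ∈ sortedUtilityList u π := List.get_mem _ _
  rw [sortedUtilityList, Multiset.mem_sort, Multiset.mem_map] at h
  obtain ⟨i, -, hi⟩ := h
  exact ⟨i, hi.symm⟩

end SortedVectors

/-! ### Leximin optimality as non-wastefulness plus balance. -/

section Owners

open Classical

variable {N O : Type*}

/-- The agent `i` has utility `1` for the item `o`. -/
def Likes (u : N → Finset O → ℝ) (i : N) (o : O) : Prop := u i {o} = 1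

/-- The agent that receives the item `o`. -/
def Allocation.owner (π : Allocation N O) (o : O) : N := (π.exhaustive o).choose

theorem Allocation.mem_bundle_iff (π : Allocation N O) {i : N} {o : O} :
    o ∈ π.bundle i ↔ π.owner o = i := by
  have h : o ∈ π.bundle (π.owner o) := (π.exhaustive o).choose_spec
  refine ⟨fun hi => ?_, fun hi => hi ▸ h⟩
  by_contra hne
  exact Finset.disjoint_left.1 (π.disjoint _ _ hne) h hi

variable [Fintype O]

/-- The allocation that gives the item `o` to `a o`. -/
def Allocation.ofOwner (a : O → N) : Allocation N O where
  bundle i := {o | a o = i}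
  disjoint i j hij := by
    rw [Finset.disjoint_left]
    intro o hi hj
    simp only [Finset.mem_filter, Finset.mem_univ, true_and] at hi hj
    exact hij (hi.symm.trans hj)
  exhaustive o := ⟨a o, by simp⟩

@[simp]
theorem Allocation.owner_ofOwner (a : O → N) : (Allocation.ofOwner a).owner = a := by
  funext o
  rw [← Allocation.mem_bundle_iff]
  simp [ofOwner]

variable {u : N → Finset O → ℝ}

theorem utility_bundle (hu : IsNormalizedTernary u) (hg : OnlyGoods u) (π : Allocation N O)
    (i : N) : u i (π.bundle i) = likedCount (Likes u) π.owner i := by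
  rw [hu.1 i, likedCount, Nat.cast_sum, ← Finset.sum_subset (Finset.subset_univ (π.bundle i))]
  · refine Finset.sum_congr rfl fun o ho => ?_
    have h0 := hg i o
    rcases hu.2 i o with h | h | h
    · rw [h] at h0; norm_num at h0
    · simp [Likes, h]
    · rw [Set.mem_singleton_iff] at h
      simp [Likes, h, π.mem_bundle_iff.1 ho]
  · intro o _ ho
    rw [π.mem_bundle_iff] at ho
    simp [ho]

variable [Fintype N]

theorem sum_min_sortedUtilities (hu : IsNormalizedTernary u) (hg : OnlyGoods u)
    (π : Allocation N O) (k : ℕ) :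
    ∑ j, min (sortedUtilities u π j) (k : ℝ) =
      ∑ i, min (likedCount (Likes u) π.owner i : ℝ) k := by
  rw [sum_sortedUtilities u π fun x => min x (k : ℝ)]
  simp only [utility_bundle hu hg]

theorem exists_nat_sortedUtilities (hu : IsNormalizedTernary u) (hg : OnlyGoods u)
    (π : Allocation N O) (j : Fin (Fintype.card N)) : ∃ k : ℕ, sortedUtilities u π j = k := by
  obtain ⟨i, hi⟩ := exists_sortedUtilities_eq u π j
  exact ⟨_, hi.trans (utility_bundle hu hg π i)⟩

theorem IsLeximinOptimal.not_sum_min_lt (hu : IsNormalizedTernary u) (hg : OnlyGoods u)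
    {π : Allocation N O} (hπ : IsLeximinOptimal u π) (a : O → N)
    (h : ∀ k : ℕ, ∑ i, min (likedCount (Likes u) π.owner i : ℝ) k ≤
      ∑ i, min (likedCount (Likes u) a i : ℝ) k) (k : ℕ) :
    ¬ ∑ i, min (likedCount (Likes u) π.owner i : ℝ) k <
      ∑ i, min (likedCount (Likes u) a i : ℝ) k := by
  intro hlt
  refine hπ ⟨.ofOwner a, leximinDominates_of_sum_min_lt (monotone_sortedUtilities u π)
    (exists_nat_sortedUtilities hu hg π) (fun k => ?_) ⟨k, ?_⟩⟩
  · simpa [sum_min_sortedUtilities hu hg] using h k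
  · simpa [sum_min_sortedUtilities hu hg] using hlt

/-- The last identity is written without subtraction and for arbitrary `F`; it serves both the
truncations and the flow costs. -/
theorem sum_transfer {x x' : N → ℕ} {i j : N} (hij : i ≠ j)
    (h : x' + Pi.single i 1 = x + Pi.single j 1) (F : ℕ → ℝ) :
    x' i + 1 = x i ∧ x' j = x j + 1 ∧
      ∑ p, F (x' p) + (F (x i) + F (x j)) = ∑ p, F (x p) + (F (x' i) + F (x' j)) := by
  have hp : ∀ p, p ≠ i → p ≠ j → x' p = x p := fun p hi hj => by
    simpa [hi, hj] using congrFun h p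
  refine ⟨by simpa [hij] using congrFun h i, by simpa [hij.symm] using congrFun h j, ?_⟩
  rw [← Finset.sum_add_sum_compl {i, j}, ← Finset.sum_add_sum_compl {i, j} fun p => F (x p),
    Finset.sum_pair hij, Finset.sum_pair hij,
    Finset.sum_congr (g := fun p => F (x p)) rfl fun p hp' => by
      simp only [Finset.mem_compl, Finset.mem_insert, Finset.mem_singleton, not_or] at hp'
      rw [hp p hp'.1 hp'.2]]
  ring

theorem IsLeximinOptimal.nonWasteful (hu : IsNormalizedTernary u) (hg : OnlyGoods u)
    {π : Allocation N O} (hπ : IsLeximinOptimal u π) : NonWasteful (Likes u) π.owner := by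
  intro q o hq
  by_contra ho
  have h := likedCount_update_of_wasted ho hq
  have hle : ∀ i, likedCount (Likes u) π.owner i ≤
      likedCount (Likes u) (Function.update π.owner o q) i := fun i => by
    rw [h]; exact Nat.le_add_right _ _
  refine hπ.not_sum_min_lt hu hg (Function.update π.owner o q)
    (fun k => Finset.sum_le_sum fun i _ => min_le_min_right _ (Nat.cast_le.2 (hle i)))
    -- The smallest truncation level that registers the extra unit of `q`.
    (likedCount (Likes u) π.owner q + 1)
    (Finset.sum_lt_sum (fun i _ => min_le_min_right _ (Nat.cast_le.2 (hle i))) ⟨q, mem_univ q, ?_⟩)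
  rw [h]
  simp

theorem IsLeximinOptimal.isBalanced (hu : IsNormalizedTernary u) (hg : OnlyGoods u)
    {π : Allocation N O} (hπ : IsLeximinOptimal u π) : IsBalanced (Likes u) π.owner := by
  intro i j hij
  by_contra! hlt
  have hne : i ≠ j := by rintro rfl; omega
  obtain ⟨a, -, ha⟩ := exists_transfer (hπ.nonWasteful hu hg) hne hij
  obtain ⟨hi, hj, -⟩ := sum_transfer hne ha fun _ => 0
  set x := likedCount (Likes u) π.owner
  set x' := likedCount (Likes u) a
  -- Concavity of truncation: the gap is at least two, so moving one unit brings the two values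
  -- closer without reversing their order. At `k = x j + 1` the poorer agent gains and the richer
  -- one stays capped, so the inequality is strict.
  have hmin : ∀ k : ℕ, min (x i) k + min (x j) k ≤ min (x' i) k + min (x' j) k := fun k => by
    omega
  have hsum : ∀ k : ℕ, _ := fun k => (sum_transfer hne ha fun n => min (n : ℝ) k).2.2
  refine hπ.not_sum_min_lt hu hg a (fun k => ?_) (x j + 1) ?_
  · have h₁ : min (x i : ℝ) k + min (x j : ℝ) k ≤ min (x' i : ℝ) k + min (x' j : ℝ) k := by
      exact_mod_cast hmin k
    linarith [hsum k]
  · have h₁ : min (x i : ℝ) (x j + 1 : ℕ) + min (x j : ℝ) (x j + 1 : ℕ) <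
        min (x' i : ℝ) (x j + 1 : ℕ) + min (x' j : ℝ) (x j + 1 : ℕ) := by
      exact_mod_cast (by omega : min (x i) (x j + 1) + min (x j) (x j + 1) <
        min (x' i) (x j + 1) + min (x' j) (x j + 1))
    linarith [hsum (x j + 1)]

theorem isLeximinOptimal_iff (hu : IsNormalizedTernary u) (hg : OnlyGoods u)
    (π : Allocation N O) :
    IsLeximinOptimal u π ↔ NonWasteful (Likes u) π.owner ∧ IsBalanced (Likes u) π.owner := by
  refine ⟨fun h => ⟨h.nonWasteful hu hg, h.isBalanced hu hg⟩, ?_⟩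
  rintro ⟨hw, hb⟩ ⟨π', hπ'⟩
  refine not_leximinDominates_of_sum_min_le (monotone_sortedUtilities u π')
    (exists_nat_sortedUtilities hu hg π') (fun k => ?_) hπ'
  simp only [sum_min_sortedUtilities hu hg]
  exact sum_min_likedCount_le hb hw π'.owner k

theorem IsLeximinOptimal.maximizesNashWelfare (hu : IsNormalizedTernary u) (hg : OnlyGoods u)
    {π : Allocation N O} (hπ : IsLeximinOptimal u π) : MaximizesNashWelfare u π := by
  intro π'
  simp only [nashWelfare, utility_bundle hu hg, Nat.abs_cast]
  exact prod_le_prod_of_sum_min_le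
    (sum_min_likedCount_le (hπ.isBalanced hu hg) (hπ.nonWasteful hu hg) π'.owner)

end Owners

/-! ### Minimum-cost flows and balanced allocations. -/

section MinCostFlows

open Node Classical

variable {N O : Type*} [Fintype O] {u : N → Finset O → ℝ}

theorem add_one_le_utility_iff (hu : IsNormalizedTernary u) (hg : OnlyGoods u)
    (π : Allocation N O) (i : N) (j : ℕ) :
    ((j : ℕ) + 1 : ℝ) ≤ u i (π.bundle i) ↔ j < likedCount (Likes u) π.owner i := by
  rw [utility_bundle hu hg]
  exact_mod_cast Nat.succ_le_iff

theorem sum_fin_ite_lt_likedCount (a : O → N) (i : N) (d : ℕ → ℝ) :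
    ∑ j : Fin (Fintype.card O), (if (j : ℕ) < likedCount (Likes u) a i then d j else 0) =
      ∑ j ∈ range (likedCount (Likes u) a i), d j := by
  rw [Fin.sum_univ_eq_sum_range fun j => if j < likedCount (Likes u) a i then d j else 0,
    sum_range_ite_lt _ (likedCount_le_card _ _ _)]

variable [Fintype N] {f : (nashNetwork u).Flow}

theorem extend_le_one (hf : IsRealizable f) (e : Node N O × Node N O) : extend f e ≤ 1 := by
  by_cases h : e ∈ (nashNetwork u).edges
  · rw [extend_of_mem f h]; exact hf.1 ⟨e, h⟩
  · rw [extend_of_not_mem f h]; exact zero_le_one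

theorem extend_source_item (hf : IsRealizable f) (o : O) : extend f (source, item o) = 1 := by
  have h : ∑ o, extend f (source, item o) = ∑ _o : O, (1 : ℝ) := by
    rw [← netFlow_source, hf.2]
    simp [nashNetwork, nashDemand]
  exact (Finset.sum_eq_sum_iff_of_le fun o _ => extend_le_one hf _).1 h o (mem_univ o)

theorem sum_extend_item (hf : IsRealizable f) (o : O) :
    ∑ i, extend f (item o, agent i) = 1 := by
  have h : netFlow f (item o) = 0 := hf.2 _
  rw [netFlow_item, extend_source_item hf] at h
  linarith

theorem sum_extend_agent (hf : IsRealizable f) (i : N) :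
    ∑ j, extend f (agent i, slot i j) = ∑ o, extend f (item o, agent i) := by
  have h : netFlow f (agent i) = 0 := hf.2 _
  rw [netFlow_agent] at h
  linarith

theorem likes_of_extend_ne_zero {o : O} {i : N} (h : extend f (item o, agent i) ≠ 0) :
    Likes u i o := by
  by_contra hL
  exact h (extend_of_not_isNashEdge f hL)

/-- A realizable flow whose truncated inflows to the agents are dominated by those of an integral
vector costs at least as much as that vector. -/
theorem le_flowCost (hf : IsRealizable f) {x : N → ℕ} (hx : ∀ i, x i ≤ Fintype.card O)
    (hsum : ∑ i, x i = Fintype.card O)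
    (h : ∀ k : ℕ, ∑ i, min (∑ o, extend f (item o, agent i)) (k : ℝ) ≤ ∑ i, min (x i : ℝ) k) :
    ∑ i, ∑ j ∈ range (x i), (Fintype.card N : ℝ) ^ (j + 1) ≤ flowCost f := by
  set m := Fintype.card O
  set n := Fintype.card N
  -- Slot flows are extended by zero to all natural indices, so that prefix sums of every length
  -- make sense.
  let g : N → ℕ → ℝ := fun i j => if hj : j < m then extend f (agent i, slot i ⟨j, hj⟩) else 0
  have hg₀ : ∀ i j, 0 ≤ g i j := fun i j => by
    simp only [g]; split_ifs
    · exact extend_nonneg f _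
    · exact le_rfl
  have hg₁ : ∀ i j, g i j ≤ 1 := fun i j => by
    simp only [g]; split_ifs
    · exact extend_le_one hf _
    · exact zero_le_one
  have hgF : ∀ i (j : Fin m), extend f (agent i, slot i j) = g i j := fun i j => by simp [g]
  have hgm : ∀ i, ∑ j ∈ range m, g i j = ∑ o, extend f (item o, agent i) := fun i => by
    rw [← sum_extend_agent hf, Finset.sum_range]
    exact Finset.sum_congr rfl fun j _ => (hgF i j).symm
  have hcost : flowCost f = ∑ j ∈ range m, (n : ℝ) ^ (j + 1) * ∑ i, g i j := by
    rw [flowCost_nashNetwork, Finset.sum_comm, Finset.sum_range]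
    refine Finset.sum_congr rfl fun j _ => ?_
    rw [Finset.mul_sum]
    exact Finset.sum_congr rfl fun i _ => by rw [hgF, mul_comm]
  have hcostx : ∑ i, ∑ j ∈ range (x i), (n : ℝ) ^ (j + 1) =
      ∑ j ∈ range m, (n : ℝ) ^ (j + 1) * ∑ i, (if j < x i then (1 : ℝ) else 0) := by
    calc _ = ∑ i, ∑ j ∈ range m, (if j < x i then (n : ℝ) ^ (j + 1) else 0) :=
          Finset.sum_congr rfl fun i _ => (sum_range_ite_lt _ (hx i)).symm
      _ = _ := by
          rw [Finset.sum_comm]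
          refine Finset.sum_congr rfl fun j _ => ?_
          rw [Finset.mul_sum]
          exact Finset.sum_congr rfl fun i _ => by split_ifs <;> simp
  -- The first `k` slots carry at most the whole inflow, and at most `k` by the unit capacities.
  have hpre : ∀ i (k : ℕ), ∑ j ∈ range k, g i j ≤ min (∑ o, extend f (item o, agent i)) k := by
    intro i k
    refine le_min ?_ ?_
    · rw [← hgm]
      calc _ ≤ ∑ j ∈ range (max k m), g i j :=
            Finset.sum_le_sum_of_subset_of_nonneg (Finset.range_mono (le_max_left _ _))
              fun j _ _ => hg₀ i j
        _ = _ := (Finset.sum_subset (Finset.range_mono (le_max_right _ _)) fun j _ hj => by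
            simp only [Finset.mem_range] at hj
            simp [g, hj]).symm
    · calc _ ≤ ∑ _j ∈ range k, (1 : ℝ) := Finset.sum_le_sum fun j _ => hg₁ i j
        _ = _ := by simp
  -- `r j` is the excess at level `j` of the integral vector, filled from the cheapest slot, over
  -- the flow. Its prefix sums are nonnegative and its total is zero, so summation by parts against
  -- the decreasing weights `-n ^ (j + 1)` compares the costs.
  let r : ℕ → ℝ := fun j => ∑ i, (if j < x i then (1 : ℝ) else 0) - ∑ i, g i j
  have hr : ∀ k, ∑ j ∈ range k, r j = ∑ i, min (x i : ℝ) k - ∑ i, ∑ j ∈ range k, g i j := by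
    intro k
    simp only [r]
    rw [Finset.sum_sub_distrib, Finset.sum_comm, Finset.sum_comm (s := range k) (t := univ)]
    simp only [sum_range_ite_lt_one]
  have hrm : ∑ j ∈ range m, r j = 0 := by
    rw [hr]
    simp only [hgm]
    rw [Finset.sum_comm (f := fun i o => extend f (item o, agent i)),
      Finset.sum_congr (s₂ := univ) rfl fun o _ => sum_extend_item hf o,
      Finset.sum_congr (s₂ := univ) rfl fun i _ =>
        min_eq_left (Nat.cast_le (α := ℝ).2 (hx i)), ← Nat.cast_sum, hsum]
    simp [m]
  have hd : Antitone fun j : ℕ => -(n : ℝ) ^ (j + 1) := by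
    refine antitone_nat_of_succ_le fun j => neg_le_neg ?_
    rcases Nat.eq_zero_or_pos n with h0 | h0
    · simp [h0]
    · exact pow_le_pow_right₀ (by exact_mod_cast h0) (Nat.le_succ _)
  have key := mul_sum_le_sum_mul hd (h := r) (fun k => by
    rw [hr]
    exact sub_nonneg.2 ((Finset.sum_le_sum fun i _ => hpre i k).trans (h k))) m
  rw [hrm, mul_zero] at key
  simp only [r, mul_sub, neg_mul, Finset.sum_sub_distrib, Finset.sum_neg_distrib] at key
  rw [hcost, hcostx]
  linarith

theorem isInteger_flowOfAllocation (π : Allocation N O) : IsInteger (flowOfAllocation u π) := by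
  intro e
  unfold flowOfAllocation
  split
  · exact ⟨1, by simp⟩
  · split_ifs
    exacts [⟨1, by simp⟩, ⟨0, by simp⟩]
  · split_ifs
    exacts [⟨1, by simp⟩, ⟨0, by simp⟩]
  · split_ifs
    exacts [⟨1, by simp⟩, ⟨0, by simp⟩]
  · exact ⟨0, by simp⟩

theorem flowOfAllocation_le_one (π : Allocation N O) (e : (nashNetwork u).edges) :
    flowOfAllocation u π e ≤ 1 := by
  unfold flowOfAllocation
  split
  · exact le_rfl
  · split_ifs <;> simp
  · split_ifs <;> simp
  · split_ifs <;> simp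
  · exact zero_le_one

theorem extend_flowOfAllocation_item {π : Allocation N O} (hL : ∀ o, Likes u (π.owner o) o)
    (o : O) (i : N) :
    extend (flowOfAllocation u π) (item o, agent i) = if π.owner o = i then 1 else 0 := by
  by_cases h : Likes u i o
  · rw [extend_of_mem _ (mem_edges.2 (show IsNashEdge u (item o, agent i) from h))]
    simp only [flowOfAllocation, π.mem_bundle_iff]
    split_ifs <;> simp
  · rw [extend_of_not_isNashEdge _ (show ¬ IsNashEdge u (item o, agent i) from h), if_neg]
    rintro rfl
    exact h (hL o)

theorem extend_flowOfAllocation_agent (hu : IsNormalizedTernary u) (hg : OnlyGoods u)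
    (π : Allocation N O) (i : N) (j : Fin (Fintype.card O)) :
    extend (flowOfAllocation u π) (agent i, slot i j) =
      if (j : ℕ) < likedCount (Likes u) π.owner i then 1 else 0 := by
  rw [extend_of_mem _ (mem_edges.2 (show IsNashEdge u (agent i, slot i j) from rfl))]
  simp only [flowOfAllocation, add_one_le_utility_iff hu hg]
  split_ifs <;> simp

theorem extend_flowOfAllocation_slot (hu : IsNormalizedTernary u) (hg : OnlyGoods u)
    (π : Allocation N O) (i : N) (j : Fin (Fintype.card O)) :
    extend (flowOfAllocation u π) (slot i j, sink) =
      if (j : ℕ) < likedCount (Likes u) π.owner i then 1 else 0 := by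
  rw [extend_of_mem _ (mem_edges.2 (show IsNashEdge u (slot i j, sink) from trivial))]
  simp only [flowOfAllocation, add_one_le_utility_iff hu hg]
  split_ifs <;> simp

theorem isRealizable_flowOfAllocation (hu : IsNormalizedTernary u) (hg : OnlyGoods u)
    {π : Allocation N O} (hL : ∀ o, Likes u (π.owner o) o) :
    IsRealizable (flowOfAllocation u π) := by
  have hsource : ∀ o, extend (flowOfAllocation u π) (source, item o) = 1 := fun o => by
    rw [extend_of_mem _ (mem_edges.2 (show IsNashEdge u (source, item o) from trivial))]
    simp [flowOfAllocation]
  have hcount := fun i => sum_fin_ite_lt_likedCount (u := u) π.owner i fun _ => 1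
  refine ⟨fun e => by exact_mod_cast flowOfAllocation_le_one π e, fun v => ?_⟩
  cases v with
  | source =>
    rw [netFlow_source]
    simp [hsource, show (nashNetwork u).demand = nashDemand from rfl, nashDemand]
  | sink =>
    rw [netFlow_sink]
    simp only [extend_flowOfAllocation_slot hu hg, hcount]
    simp only [Finset.sum_const, Finset.card_range, nsmul_one]
    rw [← Nat.cast_sum, sum_likedCount hL]
    rfl
  | item o =>
    rw [netFlow_item, hsource]
    simp [extend_flowOfAllocation_item hL, show (nashNetwork u).demand = nashDemand from rfl,
      nashDemand]
  | agent i =>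
    rw [netFlow_agent]
    simp only [extend_flowOfAllocation_agent hu hg, hcount, extend_flowOfAllocation_item hL]
    have : ∀ o, (π.owner o = i ∧ Likes u i o) ↔ π.owner o = i := fun o =>
      ⟨And.left, fun h => ⟨h, h ▸ hL o⟩⟩
    simp [likedCount, this, nashNetwork, nashDemand]
  | slot i j =>
    rw [netFlow_slot, extend_flowOfAllocation_slot hu hg, extend_flowOfAllocation_agent hu hg,
      sub_self]
    rfl

theorem flowCost_flowOfAllocation (hu : IsNormalizedTernary u) (hg : OnlyGoods u)
    (π : Allocation N O) :
    flowCost (flowOfAllocation u π) =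
      ∑ i, ∑ j ∈ range (likedCount (Likes u) π.owner i), (Fintype.card N : ℝ) ^ (j + 1) := by
  rw [flowCost_nashNetwork]
  simp only [extend_flowOfAllocation_agent hu hg, ite_mul, one_mul, zero_mul]
  exact Finset.sum_congr rfl fun i _ =>
    sum_fin_ite_lt_likedCount π.owner i fun j => (Fintype.card N : ℝ) ^ (j + 1)

theorem IsLeximinOptimal.isMinCost (hu : IsNormalizedTernary u) (hg : OnlyGoods u)
    (hex : ∀ o, ∃ i, Likes u i o) {π : Allocation N O} (hπ : IsLeximinOptimal u π) :
    IsMinCost (flowOfAllocation u π) := by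
  obtain ⟨hw, hb⟩ := (isLeximinOptimal_iff hu hg π).1 hπ
  have hL := hw.likes_owner hex
  refine ⟨isRealizable_flowOfAllocation hu hg hL, fun g hgr => ?_⟩
  rw [flowCost_flowOfAllocation hu hg]
  exact le_flowCost hgr (likedCount_le_card _ _) (sum_likedCount hL)
    (hb.sum_min_le hw (fun o i => extend g (item o, agent i)) (fun _ _ => extend_nonneg g _)
      (fun _ _ h => likes_of_extend_ne_zero h) fun o => (sum_extend_item hgr o).le)

/-- Realizability is essential: `flowOfAllocation` ignores items given to agents who do not like
them, as the corresponding edges are missing. A unit must leave each item node, which forces the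
owner to like the item. -/
theorem isAllocationOfFlow_flowOfAllocation {π : Allocation N O}
    (h : IsRealizable (flowOfAllocation u π)) :
    IsAllocationOfFlow (flowOfAllocation u π) π := by
  have hval : ∀ o i (he : (item o, agent i) ∈ (nashNetwork u).edges),
      flowOfAllocation u π ⟨(item o, agent i), he⟩ = if o ∈ π.bundle i then 1 else 0 :=
    fun _ _ _ => rfl
  have hL : ∀ o, Likes u (π.owner o) o := by
    intro o
    obtain ⟨i, -, hi⟩ := Finset.exists_ne_zero_of_sum_ne_zero
      ((sum_extend_item h o).trans_ne one_ne_zero)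
    have hLi := likes_of_extend_ne_zero hi
    rw [extend_of_mem _ (mem_edges.2 (show IsNashEdge u (item o, agent i) from hLi)), hval] at hi
    by_cases ho : o ∈ π.bundle i
    · rw [π.mem_bundle_iff] at ho
      exact ho ▸ hLi
    · simp [ho] at hi
  intro i o
  constructor
  · intro ho
    have hi := π.mem_bundle_iff.1 ho
    refine ⟨mem_edges.2 (show IsNashEdge u (item o, agent i) from hi ▸ hL o), ?_⟩
    rw [hval, if_pos ho]
  · rintro ⟨he, h1⟩
    by_contra ho
    rw [hval, if_neg ho] at h1
    exact zero_ne_one h1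

theorem isLeximinOptimal_of_isMinCost (hu : IsNormalizedTernary u) (hg : OnlyGoods u)
    {π : Allocation N O} (hf : IsMinCost f) (hfi : IsInteger f) (hfπ : IsAllocationOfFlow f π) :
    IsLeximinOptimal u π := by
  have hL : ∀ o, Likes u (π.owner o) o := fun o =>
    mem_edges.1 ((hfπ _ o).1 (π.mem_bundle_iff.2 rfl)).choose
  have hw : NonWasteful (Likes u) π.owner := fun _ o _ => hL o
  refine (isLeximinOptimal_iff hu hg π).2 ⟨hw, fun i j hij => ?_⟩
  by_contra! hlt
  have hne : i ≠ j := by rintro rfl; omega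
  -- Integrality and the unit capacities leave only the values `0` and `1`, so the flow on item
  -- edges is exactly the allocation.
  have hinflow : ∀ i, ∑ o, extend f (item o, agent i) = likedCount (Likes u) π.owner i := by
    intro i
    rw [likedCount, Nat.cast_sum]
    refine Finset.sum_congr rfl fun o _ => ?_
    by_cases hi : π.owner o = i
    · obtain ⟨he, h1⟩ := (hfπ i o).1 (π.mem_bundle_iff.2 hi)
      rw [extend_of_mem f he, h1, if_pos ⟨hi, hi ▸ hL o⟩]
      simp
    · rw [if_neg fun h => hi h.1]
      by_cases he : (item o, agent i) ∈ (nashNetwork u).edges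
      · obtain ⟨k, hk⟩ := hfi ⟨_, he⟩
        have hk1 : (f ⟨_, he⟩ : ℝ) ≤ 1 := hf.1.1 ⟨_, he⟩
        have hkne : f ⟨_, he⟩ ≠ 1 := fun h => hi (π.mem_bundle_iff.1 ((hfπ i o).2 ⟨he, h⟩))
        rw [hk] at hk1 hkne
        rw [extend_of_mem f he, hk]
        have h1 : k ≤ 1 := by exact_mod_cast hk1
        have h2 : k ≠ 1 := by exact_mod_cast hkne
        have : k = 0 := by omega
        simp [this]
      · rw [extend_of_not_mem f he]; simp
  obtain ⟨a, haw, ha⟩ := exists_transfer hw hne hij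
  have haL : ∀ o, Likes u (a o) o := haw.likes_owner fun o => ⟨_, hL o⟩
  have hle := hf.2 (flowOfAllocation u (.ofOwner a))
    (isRealizable_flowOfAllocation hu hg (by simpa using haL))
  rw [flowCost_flowOfAllocation hu hg, Allocation.owner_ofOwner] at hle
  -- Applied to the flow's own inflow vector, this says that filling the cheapest slots first costs
  -- no more than `f`, so `f` need not be shown to equal `flowOfAllocation u π`.
  have hge := le_flowCost hf.1 (likedCount_le_card (Likes u) π.owner) (sum_likedCount hL)
    fun k => by simp only [hinflow]; exact le_rfl
  obtain ⟨hi, hj, hsum⟩ := sum_transfer hne ha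
    fun x => ∑ j ∈ range x, (Fintype.card N : ℝ) ^ (j + 1)
  rw [← hi, hj, Finset.sum_range_succ, Finset.sum_range_succ] at hsum
  -- Two distinct agents make the powers strictly increasing, so the transfer strictly lowers the
  -- cost.
  have hn : (1 : ℝ) < Fintype.card N := by
    exact_mod_cast Fintype.one_lt_card_iff.2 ⟨i, j, hne⟩
  have hpow := pow_lt_pow_right₀ hn
    (by omega : likedCount (Likes u) π.owner j + 1 < likedCount (Likes u) a i + 1)
  linarith

end MinCostFlows

end FairDivision

end

open FairDivision CostFlowNetwork in
theorem mainTheorem6 {N O : Type*} [Fintype N] [Fintype O] (u : N → Finset O → ℝ)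
    (hu : IsNormalizedTernary u) (hgoods : OnlyGoods u) :
    ((∀ o, ∃ i, u i {o} = 1) →
      ∀ π : Allocation N O,
        (IsLeximinOptimal u π ↔
          ∃ f : (nashNetwork u).Flow, IsMinCost f ∧ IsInteger f ∧ IsAllocationOfFlow f π) ∧
        (IsLeximinOptimal u π ↔
          IsMinCost (flowOfAllocation u π) ∧ IsInteger (flowOfAllocation u π))) ∧
    (∀ π : Allocation N O, IsLeximinOptimal u π → MaximizesNashWelfare u π) := by
  refine ⟨fun hex π => ?_, fun π hπ => hπ.maximizesNashWelfare hu hgoods⟩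
  have hab : IsMinCost (flowOfAllocation u π) → ∃ f : (nashNetwork u).Flow,
      IsMinCost f ∧ IsInteger f ∧ IsAllocationOfFlow f π := fun h =>
    ⟨_, h, isInteger_flowOfAllocation π, isAllocationOfFlow_flowOfAllocation h.1⟩
  have hopt : (∃ f : (nashNetwork u).Flow, IsMinCost f ∧ IsInteger f ∧ IsAllocationOfFlow f π) →
      IsLeximinOptimal u π := fun ⟨_, h, hi, ha⟩ => isLeximinOptimal_of_isMinCost hu hgoods h hi ha
  exact ⟨⟨fun h => hab (h.isMinCost hu hgoods hex), hopt⟩,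
    ⟨fun h => ⟨h.isMinCost hu hgoods hex, isInteger_flowOfAllocation π⟩, fun h => hopt (hab h.1)⟩⟩
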